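/- Let $N, s\ge 1$ be integers. Let $A(\mathbb D^{4N})$ be the polydisk algebra, that is, the algebra of continuous functions on the closed polydisk $\overline{\mathbb D}^{4N}$ that are holomorphic in the open polydisk $\mathbb D^{4N}$, and let $C(\mathbb T^{4N},\mathbb C)$ be the algebra of continuous complex-valued functions on the torus $\mathbb T^{4N}=\{z\in\mathbb C^{4N}: |z_1|=\dots=|z_{4N}|=1\}$. A tuple $(h_1,\dots,h_n)$ in a commutative unital ring $A$ is called invertible if $\sum_{j=1}^n x_jh_j=1$ for some $x_1,\dots,x_n\in A$, and an invertible $(n+1)$-tuple $(h_1,\dots,h_n,k)$ is called reducible in $A$ if there are $a_1,\dots,a_n\in A$ such that $(h_1+a_1k,\dots,h_n+a_nk)$ is invertible in $A$. For $j=1,\dots,2N$ let $$f_j(z_1,\dots,z_{4N})=z_{2j-1}^s+z_{2j}^s-1,$$ and let $$g=\frac14-\sum_{j=1}^N f_jf_{N+j}.$$ Then $(f_1,\dots,f_N,g)$ is an invertible $(N+1)$-tuple in $A(\mathbb D^{4N})$ that is not reducible in $A(\mathbb D^{4N})$, and its restriction to $\mathbb T^{4N}$ is an invertible $(N+1)$-tuple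 in $C(\mathbb T^{4N},\mathbb C)$ that is not reducible in $C(\mathbb T^{4N},\mathbb C)$. -/

import Mathlib

/-- A finite tuple `(f_j)` in a commutative ring is invertible (unimodular) if the Bézout equation
`∑ x_j f_j = 1` has a solution. -/
def IsInvertibleTuple {A : Type*} [CommRing A] {n : ℕ} (f : Fin n → A) : Prop :=
  ∃ x : Fin n → A, ∑ j, x j * f j = 1

/-- The tuple `(f_1, …, f_n, g)` (with `g` the last entry of `h`) is reducible in `A` if there are
`a_j ∈ A` such that `(f_1 + a_1 g, …, f_n + a_n g)` is an invertible tuple in `A`. The notion is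
applied to invertible `(n+1)`-tuples. -/
def IsReducibleTuple {A : Type*} [CommRing A] {n : ℕ} (h : Fin (n + 1) → A) : Prop :=
  ∃ a : Fin n → A, IsInvertibleTuple (fun j : Fin n => h j.castSucc + a j * h (Fin.last n))

/-- The open unit polydisk `𝔻ⁿ`. -/
def openPolydisk (n : ℕ) : Set (Fin n → ℂ) := {z | ∀ i, ‖z i‖ < 1}

/-- The closed unit polydisk. -/
def closedPolydisk (n : ℕ) : Set (Fin n → ℂ) := {z | ∀ i, ‖z i‖ ≤ 1}

/-- The torus `𝕋ⁿ`. -/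
def torus (n : ℕ) : Set (Fin n → ℂ) := {z | ∀ i, ‖z i‖ = 1}

/-- The polydisk algebra `A(𝔻ⁿ)`: the continuous functions on the closed polydisk that are
holomorphic on the open polydisk. -/
def polydiskAlgebra (n : ℕ) : Subalgebra ℂ C(closedPolydisk n, ℂ) where
  carrier := {f | ∃ F : (Fin n → ℂ) → ℂ, DifferentiableOn ℂ F (openPolydisk n) ∧
    ∀ z : closedPolydisk n, (z : Fin n → ℂ) ∈ openPolydisk n → f z = F z}
  mul_mem' := by
    rintro f g ⟨F, hF, hfF⟩ ⟨G, hG, hgG⟩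
    exact ⟨fun z => F z * G z, hF.mul hG, fun z hz => by simp [hfF z hz, hgG z hz]⟩
  add_mem' := by
    rintro f g ⟨F, hF, hfF⟩ ⟨G, hG, hgG⟩
    exact ⟨fun z => F z + G z, hF.add hG, fun z hz => by simp [hfF z hz, hgG z hz]⟩
  algebraMap_mem' := fun c => ⟨fun _ => c, differentiableOn_const c, fun z _ => rfl⟩

/-- The restriction to the closed polydisk of an entire function, as an element of the polydisk
algebra. -/
noncomputable def toPolydiskAlgebra {n : ℕ} (f : C(Fin n → ℂ, ℂ)) (hf : Differentiable ℂ f) :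
    polydiskAlgebra n :=
  ⟨f.restrict (closedPolydisk n), f, hf.differentiableOn, fun _ _ => rfl⟩

/-- The entire function `f_j(z_1, …, z_{4N}) = z_{2j-1}^s + z_{2j}^s - 1` for `1 ≤ j ≤ 2N`.
Indices are counted from `0` here, so the variables used by index `j` are `2j` and `2j + 1`. -/
def fFun (N s : ℕ) (j : Fin (2 * N)) : C(Fin (4 * N) → ℂ, ℂ) where
  toFun z := z ⟨2 * j, by omega⟩ ^ s + z ⟨2 * j + 1, by omega⟩ ^ s - 1
  continuous_toFun := by fun_prop

/-- The entire function `g = 1/4 - ∑_{j=1}^N f_j f_{N+j}`. -/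
noncomputable def gFun (N s : ℕ) : C(Fin (4 * N) → ℂ, ℂ) where
  toFun z := 1 / 4 - ∑ j : Fin N, fFun N s ⟨j, by omega⟩ z * fFun N s ⟨N + j, by omega⟩ z
  continuous_toFun := by fun_prop

theorem differentiable_fFun (N s : ℕ) (j : Fin (2 * N)) : Differentiable ℂ (fFun N s j) := by
  change Differentiable ℂ
    (fun z : Fin (4 * N) → ℂ => z ⟨2 * j, by omega⟩ ^ s + z ⟨2 * j + 1, by omega⟩ ^ s - 1)
  fun_prop

theorem differentiable_gFun (N s : ℕ) : Differentiable ℂ (gFun N s) := by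
  change Differentiable ℂ (fun z : Fin (4 * N) → ℂ =>
    1 / 4 - ∑ j : Fin N, fFun N s ⟨j, by omega⟩ z * fFun N s ⟨N + j, by omega⟩ z)
  have h := differentiable_fFun N s
  fun_prop

/-- The `(N+1)`-tuple `(f_1, …, f_N, g)` in the polydisk algebra `A(𝔻^{4N})`. -/
noncomputable def polydiskTuple (N s : ℕ) : Fin (N + 1) → polydiskAlgebra (4 * N) :=
  Fin.snoc (α := fun _ => polydiskAlgebra (4 * N))
    (fun j : Fin N => toPolydiskAlgebra (fFun N s ⟨j, by omega⟩) (differentiable_fFun N s _))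
    (toPolydiskAlgebra (gFun N s) (differentiable_gFun N s))

/-- The `(N+1)`-tuple `(f_1, …, f_N, g)`, restricted to the torus, in `C(𝕋^{4N}, ℂ)`. -/
noncomputable def torusTuple (N s : ℕ) : Fin (N + 1) → C(torus (4 * N), ℂ) :=
  Fin.snoc (α := fun _ => C(torus (4 * N), ℂ))
    (fun j : Fin N => (fFun N s ⟨j, by omega⟩).restrict (torus (4 * N)))
    ((gFun N s).restrict (torus (4 * N)))

/-! Invertibility is the identity `4 ∑ f_j f_{N+j} + 4 g = 1`. Reducibility passes along the
restriction homomorphism, so it is enough to refute it on the torus. If `‖w‖ ≤ 1/2`, then `1 + w` is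
a sum of two `s`-th powers of unimodular numbers that depend continuously on `w`. Hence each `y ∈
ℂ^N` with `‖y‖ ≤ 1/2` lifts continuously to a torus point where `f_j = y_j` and `f_{N+j} = conj
y_j`, so that `g = 1/4 - ‖y‖²`. Along this lift `f + a g` becomes `y + a(y) (1/4 - ‖y‖²)`, the
identity on the sphere of radius `1/2`. By Brouwer it has a zero, a common zero of all `f_j + a_j g`
(`fFun_add_mul_gFun_exists_zero`). Brouwer's theorem is derived from
`not_exists_contDiff_retraction`, by the Milnor–Rogers volume argument. -/

open MeasureTheory Metric Module

/-! ### Determinants of `1 + t A` -/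

section Determinant

variable {E : Type*} [NormedAddCommGroup E] [NormedSpace ℝ E] [FiniteDimensional ℝ E]

/-- Along `t ∈ [0, 1]` the map `1 + t A` stays injective, so its determinant cannot change sign from
its value `1` at `t = 0`. -/
theorem ContinuousLinearMap.det_one_add_pos {A : E →L[ℝ] E} (hA : ‖A‖ < 1) :
    0 < (1 + A).det := by
  have key : ∀ t ∈ Set.Icc (0 : ℝ) 1, (1 + t • A).det ≠ 0 := by
    intro t ht h0
    obtain ⟨v, hv, hv0⟩ : ∃ v, (1 + t • A) v = 0 ∧ v ≠ 0 := by
      have := LinearMap.bot_lt_ker_of_det_eq_zero (f := ((1 + t • A : E →L[ℝ] E) : E →ₗ[ℝ] E)) h0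
      obtain ⟨v, hv, hv0⟩ := (Submodule.ne_bot_iff _).1 this.ne'
      exact ⟨v, hv, hv0⟩
    have h1 : v = -(t • A v) := by
      simpa [add_eq_zero_iff_eq_neg] using hv
    have h2 : ‖v‖ = t * ‖A v‖ := by
      conv_lhs => rw [h1]
      rw [norm_neg, norm_smul, Real.norm_of_nonneg ht.1]
    have h3 : 0 < ‖v‖ := norm_pos_iff.2 hv0
    have h4 := A.le_opNorm v
    have h5 : t * ‖A v‖ ≤ ‖A v‖ := mul_le_of_le_one_left (norm_nonneg _) ht.2
    nlinarith
  have hc : ContinuousOn (fun t : ℝ => (1 + t • A).det) (Set.Icc 0 1) := by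
    exact (ContinuousLinearMap.continuous_det.comp (by fun_prop :
      Continuous fun t : ℝ => 1 + t • A)).continuousOn
  by_contra! hneg
  have : (0 : ℝ) ∈ (fun t : ℝ => (1 + t • A).det) '' Set.Icc 0 1 :=
    intermediate_value_Icc' zero_le_one hc ⟨by simpa using hneg, by
      simp [ContinuousLinearMap.det]⟩
  obtain ⟨t, ht, h⟩ := this
  exact key t ht h

/-- `det (1 + t A)` is a polynomial in `t` of degree at most the dimension, so Lagrange
interpolation recovers its value at `t = 1`. The weights do not depend on `A`, which lets the
identity be integrated over a family of maps. -/
theorem LinearMap.exists_sum_det_one_add_smul (u : ℕ → ℝ) (hu : Function.Injective u) :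
    ∃ c : ℕ → ℝ, ∑ i ∈ Finset.range (finrank ℝ E + 1), c i = 1 ∧ ∀ A : E →ₗ[ℝ] E,
      LinearMap.det (1 + A) =
        ∑ i ∈ Finset.range (finrank ℝ E + 1), c i * LinearMap.det (1 + u i • A) := by
  classical
  set s := Finset.range (finrank ℝ E + 1)
  refine ⟨fun i => (Lagrange.basis s u i).eval 1, ?_, fun A => ?_⟩
  · rw [← Polynomial.eval_finsetSum, Lagrange.sum_basis hu.injOn ⟨0, by simp [s]⟩,
      Polynomial.eval_one]
  · let b := finBasis ℝ E
    let M := LinearMap.toMatrix b b A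
    let p : Polynomial ℝ := ((Polynomial.X : Polynomial ℝ) • M.map Polynomial.C +
      (1 : Matrix _ _ ℝ).map Polynomial.C).det
    have hp : ∀ t : ℝ, p.eval t = LinearMap.det (1 + t • A) := by
      intro t
      rw [← LinearMap.det_toMatrix b, ← Polynomial.coe_evalRingHom, RingHom.map_det]
      congr 1
      ext i j
      by_cases hij : i = j <;>
        simp [M, hij, LinearMap.toMatrix_one, add_comm] <;> ring
    have hdeg : p.degree < s.card := by
      refine lt_of_le_of_lt (Polynomial.degree_le_of_natDegree_le
        (Polynomial.natDegree_det_X_add_C_le _ _)) ?_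
      simp [s]
      exact_mod_cast Nat.lt_succ_self _
    have h1 := congrArg (Polynomial.eval 1) (Lagrange.eq_interpolate (v := u) hu.injOn hdeg)
    rw [hp, one_smul, Lagrange.interpolate_apply, Polynomial.eval_finsetSum] at h1
    rw [h1]
    refine Finset.sum_congr rfl fun i _ => ?_
    rw [Polynomial.eval_mul, Polynomial.eval_C, hp, mul_comm]

end Determinant

/-! ### Lipschitz perturbations of the identity -/

section Perturbation

variable {E : Type*} [NormedAddCommGroup E]

/-- A segment leaving the ball crosses the sphere, where `h` vanishes. -/
theorem lipschitzWith_indicator_ball [NormedSpace ℝ E] {h : E → E} {R : ℝ} {L : NNReal}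
    (hL : LipschitzOnWith L h (closedBall 0 R)) (h0 : ∀ x ∈ sphere (0 : E) R, h x = 0) :
    LipschitzWith L ((ball (0 : E) R).indicator h) := by
  have key : ∀ x ∈ ball (0 : E) R, ∀ y ∉ ball (0 : E) R, ‖h x‖ ≤ L * ‖x - y‖ := by
    intro x hx y hy
    rw [mem_ball_zero_iff] at hx hy
    have hc : ContinuousOn (fun t : ℝ => ‖x + t • (y - x)‖) (Set.Icc 0 1) := by fun_prop
    obtain ⟨t, ht, htR⟩ := intermediate_value_Icc zero_le_one hc
      (show R ∈ Set.Icc _ _ by constructor <;> simp <;> linarith)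
    have hz : x + t • (y - x) ∈ sphere (0 : E) R := by simpa using htR
    have h1 := hL.norm_sub_le (x := x) (y := x + t • (y - x)) (by simpa using hx.le)
      (sphere_subset_closedBall hz)
    rw [h0 _ hz, sub_zero] at h1
    refine h1.trans ?_
    gcongr
    rw [sub_add_cancel_left, norm_neg, norm_smul, norm_sub_rev y x, Real.norm_of_nonneg ht.1]
    exact mul_le_of_le_one_left (norm_nonneg _) ht.2
  refine LipschitzWith.of_dist_le_mul fun x y => ?_
  rw [dist_eq_norm, dist_eq_norm]
  by_cases hx : x ∈ ball (0 : E) R <;> by_cases hy : y ∈ ball (0 : E) R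
  · simpa [Set.indicator_of_mem, hx, hy] using
      hL.norm_sub_le (ball_subset_closedBall hx) (ball_subset_closedBall hy)
  · simpa [hx, hy] using key x hx y hy
  · simpa [hx, hy, norm_sub_rev] using key y hy x hx
  · simp only [Set.indicator_of_notMem hx, Set.indicator_of_notMem hy, sub_zero, norm_zero]
    positivity

theorem LipschitzWith.injective_id_add {h : E → E} {K : NNReal} (hh : LipschitzWith K h)
    (hK : K < 1) : Function.Injective fun x => x + h x := by
  intro x y hxy
  have h1 := hh.norm_sub_le x y
  have h2 : x - y = -(h x - h y) := by
    have : x + h x = y + h y := hxy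
    rw [neg_sub, sub_eq_sub_iff_add_eq_add, this, add_comm]
  have h3 : ‖x - y‖ ≤ K * ‖x - y‖ := by
    conv_lhs => rw [h2, norm_neg]
    exact h1
  have h4 : (K : ℝ) < 1 := hK
  have h5 : ‖x - y‖ = 0 := by nlinarith [norm_nonneg (x - y)]
  exact sub_eq_zero.1 (norm_eq_zero.1 h5)

theorem LipschitzWith.surjective_id_add [CompleteSpace E] {h : E → E} {K : NNReal}
    (hh : LipschitzWith K h) (hK : K < 1) : Function.Surjective fun x => x + h x := by
  intro y
  have hc : ContractingWith K fun x => y - h x :=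
    ⟨hK, LipschitzWith.of_dist_le_mul fun a b => by
      simpa [dist_eq_norm, norm_sub_rev] using hh.norm_sub_le a b⟩
  refine ⟨hc.fixedPoint, ?_⟩
  have := hc.fixedPoint_isFixedPt.eq
  dsimp only at this ⊢
  nth_rw 1 [← this]
  abel

end Perturbation

/-! ### No-retraction theorem and Brouwer -/

section NoRetraction

variable {E : Type*} [NormedAddCommGroup E] [InnerProductSpace ℝ E] [FiniteDimensional ℝ E]

/-- A differentiable map into a sphere has degenerate derivative. -/
theorem det_eq_zero_of_norm_eq {r : E → E} {R : ℝ} (hR : 0 < R) (hr : ∀ x, ‖r x‖ = R) {x : E}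
    {r' : E →L[ℝ] E} (hd : HasFDerivAt r r' x) : r'.det = 0 := by
  by_contra hdet
  -- In this direction the constant `‖r‖²` would have derivative `2 R² ≠ 0`.
  obtain ⟨v, hv⟩ : ∃ v, r' v = r x :=
    (LinearMap.equivOfDetNeZero (r' : E →ₗ[ℝ] E) hdet).surjective (r x)
  have h1 := hd.norm_sq
  have h2 : HasFDerivAt (fun y => ‖r y‖ ^ 2) (0 : E →L[ℝ] ℝ) x := by
    simp only [hr]
    exact hasFDerivAt_const _ _
  have h3 := congrArg (fun T => T v) (h1.unique h2)
  simp [hv, hr] at h3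
  exact hR.ne' h3

/-- With `h = r - id`, the map `id + t h` carries the ball bijectively onto itself for small `t >
0`, so the integral of `det (1 + t h')` is the volume of the ball. It is polynomial in `t`, so this
persists at `t = 1`, where the integrand is `det r' = 0`. -/
theorem not_exists_contDiff_retraction {r : E → E} (hr : ContDiff ℝ 1 r) {R : ℝ} (hR : 0 < R)
    (hrR : ∀ x, ‖r x‖ = R) (hfix : ∀ x ∈ sphere (0 : E) R, r x = x) : False := by
  borelize E
  let h : E → E := fun x => r x - x
  have hh : ContDiff ℝ 1 h := hr.sub contDiff_id
  have hd : Differentiable ℝ h := hh.differentiable one_ne_zero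
  have hcont : Continuous (fderiv ℝ h) := hh.continuous_fderiv one_ne_zero
  obtain ⟨C, hC⟩ := (isCompact_closedBall (0 : E) R).exists_bound_of_continuousOn
    hcont.continuousOn
  let L : NNReal := ⟨max C 0, le_max_right _ _⟩
  have hCL : ∀ x ∈ closedBall (0 : E) R, ‖fderiv ℝ h x‖ ≤ L := fun x hx =>
    (hC x hx).trans (le_max_left _ _)
  have hL : LipschitzOnWith L h (closedBall 0 R) :=
    (convex_closedBall 0 R).lipschitzOnWith_of_nnnorm_fderiv_le (𝕜 := ℝ)
      (fun x _ => hd x) (fun x hx => hCL x hx)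
  have hind := lipschitzWith_indicator_ball hL (fun x hx => by simp [h, hfix x hx])
  have hvol : ∀ t : ℝ, 0 < t → t * L < 1 → t < 1 →
      ∫ x in ball (0 : E) R, (1 + t • fderiv ℝ h x).det = volume.real (ball (0 : E) R) := by
    intro t ht htL ht1
    let T : NNReal := ⟨t, ht.le⟩
    have hTL : T * L < 1 := by exact_mod_cast htL
    have hlip : LipschitzWith (T * L) fun x => t • (ball (0 : E) R).indicator h x := by
      refine LipschitzWith.of_dist_le_mul fun a b => ?_
      rw [dist_smul₀, Real.norm_of_nonneg ht.le, NNReal.coe_mul, mul_assoc]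
      exact mul_le_mul_of_nonneg_left (hind.dist_le_mul a b) ht.le
    have hinj := hlip.injective_id_add hTL
    have hsurj := hlip.surjective_id_add hTL
    have heq : Set.EqOn (fun x => x + t • h x)
        (fun x => x + t • (ball (0 : E) R).indicator h x) (ball 0 R) := fun x hx => by
      simp only [Set.indicator_of_mem hx]
    have himg : (fun x => x + t • h x) '' ball (0 : E) R = ball 0 R := by
      apply Set.Subset.antisymm
      · rintro _ ⟨x, hx, rfl⟩
        rw [mem_ball_zero_iff] at hx ⊢
        have : x + t • h x = (1 - t) • x + t • r x := by
          simp only [h]; module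
        dsimp only
        rw [this]
        refine (norm_add_le _ _).trans_lt ?_
        rw [norm_smul, norm_smul, hrR, Real.norm_of_nonneg ht.le,
          Real.norm_of_nonneg (by linarith)]
        nlinarith
      -- The perturbation cut off outside the ball is onto and fixes the exterior, so preimages of
      -- interior points are interior.
      · intro y hy
        obtain ⟨x, hx⟩ := hsurj y
        by_cases hxR : x ∈ ball (0 : E) R
        · exact ⟨x, hxR, (heq hxR).trans hx⟩
        · simp only [Set.indicator_of_notMem hxR, smul_zero, add_zero] at hx
          exact absurd (hx ▸ hy) hxR
    have hcv := integral_image_eq_integral_abs_det_fderiv_smul volume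
      (measurableSet_ball (x := (0 : E)) (ε := R)) (f := fun x => x + t • h x)
      (f' := fun x => 1 + t • fderiv ℝ h x)
      (fun x _ => ((hasFDerivAt_id x).add ((hd x).hasFDerivAt.const_smul t)).hasFDerivWithinAt)
      (heq.injOn_iff.2 hinj.injOn) (fun _ => (1 : ℝ))
    rw [himg] at hcv
    simp only [smul_eq_mul, mul_one, integral_const, MeasurableSet.univ, measureReal_restrict_apply,
      Set.univ_inter] at hcv
    rw [hcv]
    refine setIntegral_congr_fun measurableSet_ball fun x hx => ?_
    refine (abs_of_pos (ContinuousLinearMap.det_one_add_pos ?_)).symm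
    rw [norm_smul, Real.norm_of_nonneg ht.le]
    exact (mul_le_mul_of_nonneg_left (hCL x (ball_subset_closedBall hx)) ht.le).trans_lt htL
  -- Distinct nodes small enough for `hvol`.
  let u : ℕ → ℝ := fun i => 1 / ((L + 2) + i)
  have hL0 : (0 : ℝ) ≤ L := L.2
  have hu : Function.Injective u := by
    intro i j hij
    simp only [u, one_div, inv_inj, add_right_inj, Nat.cast_inj] at hij
    exact hij
  have huvol : ∀ i, ∫ x in ball (0 : E) R, (1 + u i • fderiv ℝ h x).det =
      volume.real (ball (0 : E) R) := by
    intro i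
    have hpos : (0 : ℝ) < L + 2 + i := by positivity
    have hi : (0 : ℝ) ≤ i := by positivity
    refine hvol _ (by positivity) ?_ ?_
    · simp only [u]
      rw [one_div_mul_eq_div, div_lt_one hpos]
      linarith
    · simp only [u]
      rw [div_lt_one hpos]
      linarith
  obtain ⟨c, hc1, hc⟩ := LinearMap.exists_sum_det_one_add_smul (E := E) u hu
  have hzero : ∀ x, (1 + fderiv ℝ h x).det = 0 := fun x => by
    refine det_eq_zero_of_norm_eq hR hrR (x := x) ?_
    have := (hasFDerivAt_id x).add (hd x).hasFDerivAt
    convert this using 1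
    · ext y
      simp [h]
    · rfl
  have hsum : ∀ x, ∑ i ∈ Finset.range (finrank ℝ E + 1),
      c i * (1 + u i • fderiv ℝ h x).det = 0 := fun x =>
    (hc (fderiv ℝ h x : E →ₗ[ℝ] E)).symm.trans (hzero x)
  have hint : ∀ i, IntegrableOn (fun x => c i * (1 + u i • fderiv ℝ h x).det)
      (ball (0 : E) R) := fun i => by
    have hdet : Continuous fun x => (1 + u i • fderiv ℝ h x).det :=
      ContinuousLinearMap.continuous_det.comp (by fun_prop)
    exact IntegrableOn.mono_set (ContinuousOn.integrableOn_compact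
      (isCompact_closedBall (0 : E) R) (hdet.const_mul _).continuousOn) ball_subset_closedBall
  have h1 := integral_finsetSum (Finset.range (finrank ℝ E + 1)) (fun i _ => hint i)
  simp only [hsum, integral_zero, integral_const_mul, huvol, ← Finset.sum_mul, hc1, one_mul] at h1
  have h2 : 0 < volume.real (ball (0 : E) R) :=
    ENNReal.toReal_pos (measure_ball_pos _ _ hR).ne' measure_ball_lt_top.ne
  exact h2.ne h1

/-- A form of Brouwer's theorem: a continuous self-map of a finite-dimensional space that is the
identity outside a ball has a zero. -/
theorem exists_eq_zero_of_eq_self_off_ball {G : E → E} (hG : Continuous G) {R : ℝ} (hR : 0 < R)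
    (hfix : ∀ x, R ≤ ‖x‖ → G x = x) : ∃ x, G x = 0 := by
  by_contra! hne
  obtain ⟨ε, hε, hεG⟩ : ∃ ε > 0, ∀ x, ε ≤ ‖G x‖ := by
    obtain ⟨x₀, -, hx₀⟩ := (isCompact_closedBall (0 : E) R).exists_isMinOn
      ⟨0, by simp [hR.le]⟩ hG.norm.continuousOn
    refine ⟨min R ‖G x₀‖, lt_min hR (norm_pos_iff.2 (hne x₀)), fun x => ?_⟩
    by_cases hx : ‖x‖ ≤ R
    · exact (min_le_right _ _).trans (hx₀ (by simpa using hx))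
    · rw [hfix x (not_le.1 hx).le]
      exact (min_le_left _ _).trans (not_le.1 hx).le
  -- The approximation `k` is supported where `G x ≠ x`, so `x + k x` still fixes the sphere.
  obtain ⟨k, hk, hkd, hks⟩ := Continuous.exists_contDiff_approx 1 (f := fun x => G x - x)
    (hG.sub continuous_id) (ε := fun _ => ε) continuous_const (fun _ => hε)
  have hne' : ∀ x, x + k x ≠ 0 := fun x h0 => by
    have h1 := hkd x
    have h2 := hεG x
    rw [dist_eq_norm, show k x - (G x - x) = -G x by rw [← zero_sub, ← h0]; abel, norm_neg] at h1
    linarith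
  have hsm : ContDiff ℝ 1 fun x => x + k x := contDiff_id.add hk
  refine not_exists_contDiff_retraction (r := fun x => (R / ‖x + k x‖) • (x + k x)) ?_ hR ?_ ?_
  · exact (contDiff_const.div (hsm.norm ℝ hne') fun x => norm_ne_zero_iff.2 (hne' x)).smul hsm
  · intro x
    have := norm_pos_iff.2 (hne' x)
    rw [norm_smul, Real.norm_of_nonneg (by positivity)]
    field_simp
  · intro x hx
    rw [mem_sphere_zero_iff_norm] at hx
    have hkx : k x = 0 := by
      by_contra hkx
      exact hks hkx (by simp [hfix x hx.ge])
    rw [hkx, add_zero, hx, div_self hR.ne', one_smul]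

end NoRetraction

open ComplexConjugate

/-! ### Lifting to the torus -/

section Section

/-- For `ε = ±1`, the two points `torusSection s ε w` of the unit circle have `s`-th powers whose
sum is `1 + w`. -/
noncomputable def torusSection (s : ℕ) (ε : ℝ) (w : ℂ) : ℂ :=
  Complex.exp (((Complex.arg (1 + w) + ε * Real.arccos (‖1 + w‖ / 2)) / s : ℝ) * Complex.I)

theorem norm_torusSection (s : ℕ) (ε : ℝ) (w : ℂ) : ‖torusSection s ε w‖ = 1 :=
  Complex.norm_exp_ofReal_mul_I _

/-- The bound on `w` keeps `1 + w` in the right half-plane, away from the cut of `arg`. -/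
theorem continuousOn_torusSection (s : ℕ) (ε : ℝ) :
    ContinuousOn (torusSection s ε) {w | ‖w‖ ≤ 1 / 2} := by
  have harg : ContinuousOn (fun w : ℂ => Complex.arg (1 + w)) {w | ‖w‖ ≤ 1 / 2} := by
    intro w hw
    have hslit : 1 + w ∈ Complex.slitPlane := by
      left
      have h1 := (Complex.abs_re_le_norm w).trans hw
      have h2 := neg_abs_le w.re
      simp only [Complex.add_re, Complex.one_re]
      linarith
    exact ((Complex.continuousAt_arg hslit).comp (f := fun w : ℂ => 1 + w)
      (by fun_prop)).continuousWithinAt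
  have hcos : Continuous fun w : ℂ => Real.arccos (‖1 + w‖ / 2) :=
    Real.continuous_arccos.comp (by fun_prop)
  have hcos' := hcos.continuousOn (s := {w | ‖w‖ ≤ 1 / 2})
  have hre : ContinuousOn (fun w : ℂ =>
      (Complex.arg (1 + w) + ε * Real.arccos (‖1 + w‖ / 2)) / s) {w | ‖w‖ ≤ 1 / 2} :=
    (harg.add (continuousOn_const.mul hcos')).div_const _
  exact Complex.continuous_exp.comp_continuousOn
    ((Complex.continuous_ofReal.comp_continuousOn hre).mul continuousOn_const)

theorem torusSection_pow {s : ℕ} (hs : 1 ≤ s) (ε : ℝ) (w : ℂ) :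
    torusSection s ε w ^ s = Complex.exp (Complex.arg (1 + w) * Complex.I) *
      Complex.exp (ε * Real.arccos (‖1 + w‖ / 2) * Complex.I) := by
  have hs0 : (s : ℂ) ≠ 0 := by exact_mod_cast (by omega : s ≠ 0)
  rw [torusSection, ← Complex.exp_nat_mul, ← Complex.exp_add]
  congr 1
  push_cast
  field_simp

/-- `e^{iα} (e^{iβ} + e^{-iβ}) = 2 cos β e^{iα}`, with `α = arg (1 + w)` and `2 cos β = ‖1 + w‖`. -/
theorem torusSection_pow_add_pow {s : ℕ} (hs : 1 ≤ s) {w : ℂ} (hw : ‖w‖ ≤ 1 / 2) :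
    torusSection s 1 w ^ s + torusSection s (-1) w ^ s - 1 = w := by
  have hn : ‖1 + w‖ / 2 ≤ 1 := by
    have := norm_add_le 1 w
    rw [norm_one] at this
    linarith
  have hcos : 2 * Complex.cos (Real.arccos (‖1 + w‖ / 2)) = ‖1 + w‖ := by
    rw [← Complex.ofReal_cos, Real.cos_arccos (by linarith [norm_nonneg (1 + w)]) hn]
    push_cast
    ring
  rw [torusSection_pow hs, torusSection_pow hs, ← mul_add]
  push_cast
  rw [one_mul, neg_one_mul, ← Complex.two_cos, hcos, mul_comm, Complex.norm_mul_exp_arg_mul_I]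
  ring

variable {N : ℕ}

/-- The vector `(y, conj y)`. -/
noncomputable def appendConj (y : Fin N → ℂ) (j : Fin (2 * N)) : ℂ :=
  if h : (j : ℕ) < N then y ⟨j, h⟩ else conj (y ⟨j - N, by omega⟩)

theorem continuous_appendConj (j : Fin (2 * N)) :
    Continuous fun y : Fin N → ℂ => appendConj y j := by
  unfold appendConj
  split_ifs
  · fun_prop
  · exact Complex.continuous_conj.comp (continuous_apply _)

theorem norm_appendConj_le {y : Fin N → ℂ} {c : ℝ} (hy : ∀ i, ‖y i‖ ≤ c) (j : Fin (2 * N)) :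
    ‖appendConj y j‖ ≤ c := by
  unfold appendConj
  split_ifs
  · exact hy _
  · rw [RCLike.norm_conj]
    exact hy _

/-- A point of the torus at which `fFun N s j` takes the value `x j`. -/
noncomputable def torusPoint (s : ℕ) (x : Fin (2 * N) → ℂ) (k : Fin (4 * N)) : ℂ :=
  torusSection s (if (k : ℕ) % 2 = 0 then 1 else -1) (x ⟨k / 2, by omega⟩)

theorem torusPoint_mem (s : ℕ) (x : Fin (2 * N) → ℂ) : torusPoint s x ∈ torus (4 * N) :=
  fun _ => norm_torusSection _ _ _

theorem fFun_torusPoint {s : ℕ} (hs : 1 ≤ s) {x : Fin (2 * N) → ℂ} {j : Fin (2 * N)}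
    (hx : ‖x j‖ ≤ 1 / 2) : fFun N s j (torusPoint s x) = x j := by
  have h1 : (2 * (j : ℕ) + 1) % 2 ≠ 0 := by omega
  have h2 : (2 * (j : ℕ) + 1) / 2 = j := by omega
  have h3 : 2 * (j : ℕ) / 2 = j := by omega
  change torusPoint s x ⟨2 * j, _⟩ ^ s + torusPoint s x ⟨2 * j + 1, _⟩ ^ s - 1 = _
  simp only [torusPoint, h1, h2, h3, Nat.mul_mod_right, if_true, if_false]
  exact torusSection_pow_add_pow hs hx

theorem gFun_torusPoint {s : ℕ} (hs : 1 ≤ s) {y : EuclideanSpace ℂ (Fin N)}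
    (hy : ∀ i, ‖y i‖ ≤ 1 / 2) :
    gFun N s (torusPoint s (appendConj y)) = ((1 / 4 - ‖y‖ ^ 2 : ℝ) : ℂ) := by
  change (1 / 4 - ∑ j : Fin N, fFun N s ⟨j, _⟩ _ * fFun N s ⟨N + j, _⟩ _ : ℂ) = _
  simp only [fFun_torusPoint hs (norm_appendConj_le hy _)]
  rw [EuclideanSpace.norm_sq_eq]
  push_cast
  congr 1
  refine Finset.sum_congr rfl fun j _ => ?_
  simp [appendConj, Complex.mul_conj']

end Section

/-! ### Invertibility and non-reducibility of the tuples -/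

section Tuples

variable {N s : ℕ}

theorem fFun_add_mul_gFun_exists_zero (hs : 1 ≤ s) (a : Fin N → C(torus (4 * N), ℂ)) :
    ∃ z : torus (4 * N), ∀ j : Fin N, fFun N s ⟨j, by omega⟩ z + a j z * gFun N s z = 0 := by
  let E := EuclideanSpace ℂ (Fin N)
  -- Radial retraction onto the ball of radius `1/2`, where the lift is continuous; it makes `τ`
  -- continuous on all of `E`.
  let P : E → E := fun x => ((1 / 2) / max (1 / 2) ‖x‖ : ℝ) • x
  have hmax : ∀ x : E, 0 < max (1 / 2) ‖x‖ := fun x => lt_max_of_lt_left (by norm_num)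
  have hPc : Continuous P :=
    (continuous_const.div (continuous_const.max continuous_norm) fun x => (hmax x).ne').smul
      continuous_id
  have hPn : ∀ x, ‖P x‖ ≤ 1 / 2 := fun x => by
    rw [norm_smul, Real.norm_of_nonneg (by have := hmax x; positivity), div_mul_eq_mul_div,
      div_le_iff₀ (hmax x)]
    gcongr
    exact le_max_right _ _
  have hPi : ∀ x i, ‖P x i‖ ≤ 1 / 2 := fun x i => (PiLp.norm_apply_le (P x) i).trans (hPn x)
  have hPx : ∀ x : E, ‖x‖ ≤ 1 / 2 → P x = x := fun x hx => by
    simp only [P, max_eq_left hx]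
    norm_num
  let τ : E → torus (4 * N) := fun x => ⟨torusPoint s (appendConj (P x)), torusPoint_mem _ _⟩
  have hτ : Continuous τ := by
    refine Continuous.subtype_mk (continuous_pi fun k => ?_) _
    exact (continuousOn_torusSection s _).comp_continuous
      ((continuous_appendConj _).comp ((PiLp.continuous_ofLp 2 _).comp hPc))
      fun x => norm_appendConj_le (hPi x) _
  -- The cutoff `max 0` makes `G` the identity outside the ball without changing it inside.
  let G : E → E := fun x =>
    x + WithLp.toLp 2 fun j => a j (τ x) * ((max 0 (1 / 4 - ‖x‖ ^ 2) : ℝ) : ℂ)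
  have hG : Continuous G := by
    refine continuous_id.add ((PiLp.continuous_toLp 2 _).comp (continuous_pi fun j => ?_))
    exact ((a j).continuous.comp hτ).mul (Complex.continuous_ofReal.comp
      (continuous_const.max (by fun_prop)))
  have hfix : ∀ x, 1 / 2 ≤ ‖x‖ → G x = x := fun x hx => by
    have : max 0 (1 / 4 - ‖x‖ ^ 2) = 0 := max_eq_left (by nlinarith)
    ext j
    change x j + a j (τ x) * ((max 0 (1 / 4 - ‖x‖ ^ 2) : ℝ) : ℂ) = x j
    rw [this, Complex.ofReal_zero, mul_zero, add_zero]
  obtain ⟨x, hx⟩ := exists_eq_zero_of_eq_self_off_ball hG (by norm_num) hfix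
  have hxn : ‖x‖ ≤ 1 / 2 := by
    by_contra! h
    rw [hfix x h.le] at hx
    rw [hx, norm_zero] at h
    norm_num at h
  have hxi : ∀ i, ‖x i‖ ≤ 1 / 2 := fun i => (PiLp.norm_apply_le x i).trans hxn
  refine ⟨τ x, fun j => ?_⟩
  have hτx : (τ x : Fin (4 * N) → ℂ) = torusPoint s (appendConj x) := by simp only [τ, hPx x hxn]
  have hm : max 0 (1 / 4 - ‖x‖ ^ 2) = 1 / 4 - ‖x‖ ^ 2 :=
    max_eq_right (by nlinarith [norm_nonneg x])
  have hj : x j + a j (τ x) * ((max 0 (1 / 4 - ‖x‖ ^ 2) : ℝ) : ℂ) = 0 :=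
    congrFun (congrArg WithLp.ofLp hx) j
  rw [hτx, gFun_torusPoint hs hxi, fFun_torusPoint hs (norm_appendConj_le hxi _), ← hm, ← hj]
  simp [appendConj]

theorem not_isReducibleTuple_torusTuple (hs : 1 ≤ s) : ¬ IsReducibleTuple (torusTuple N s) := by
  rintro ⟨a, x, hx⟩
  obtain ⟨z, hz⟩ := fFun_add_mul_gFun_exists_zero hs a
  have h1 := congrArg (fun φ : C(torus (4 * N), ℂ) => φ z) hx
  simp [torusTuple, hz] at h1

theorem torus_subset_closedPolydisk (n : ℕ) : torus n ⊆ closedPolydisk n :=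
  fun _ hz i => (hz i).le

/-- The restriction homomorphism from the polydisk algebra to the continuous functions on the
torus. -/
noncomputable def restrictTorus (n : ℕ) : polydiskAlgebra n →ₐ[ℂ] C(torus n, ℂ) :=
  (ContinuousMap.compRightAlgHom ℂ ℂ
    ⟨Set.inclusion (torus_subset_closedPolydisk n), continuous_inclusion _⟩).comp
    (polydiskAlgebra n).val

theorem restrictTorus_polydiskTuple (i : Fin (N + 1)) :
    restrictTorus (4 * N) (polydiskTuple N s i) = torusTuple N s i := by
  refine Fin.lastCases ?_ (fun j => ?_) i
  · simp only [polydiskTuple, torusTuple, Fin.snoc_last]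
    rfl
  · simp only [polydiskTuple, torusTuple, Fin.snoc_castSucc]
    rfl

theorem IsInvertibleTuple.map {A B : Type*} [CommRing A] [CommRing B] (φ : A →+* B) {n : ℕ}
    {f : Fin n → A} (hf : IsInvertibleTuple f) : IsInvertibleTuple fun j => φ (f j) := by
  obtain ⟨x, hx⟩ := hf
  exact ⟨fun j => φ (x j), by rw [← map_one φ, ← hx, map_sum]; simp only [map_mul]⟩

theorem IsReducibleTuple.map {A B : Type*} [CommRing A] [CommRing B] (φ : A →+* B) {n : ℕ}
    {h : Fin (n + 1) → A} (hh : IsReducibleTuple h) : IsReducibleTuple fun j => φ (h j) := by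
  obtain ⟨a, ha⟩ := hh
  refine ⟨fun j => φ (a j), ?_⟩
  simpa only [map_add, map_mul] using ha.map φ

theorem isInvertibleTuple_polydiskTuple (N s : ℕ) : IsInvertibleTuple (polydiskTuple N s) := by
  refine ⟨Fin.snoc (α := fun _ => polydiskAlgebra (4 * N)) (fun j : Fin N =>
    4 * toPolydiskAlgebra (fFun N s ⟨N + j, by omega⟩) (differentiable_fFun N s _)) 4, ?_⟩
  rw [Fin.sum_univ_castSucc]
  simp only [polydiskTuple, Fin.snoc_castSucc, Fin.snoc_last]
  apply Subtype.ext
  ext z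
  have hg : gFun N s z = 1 / 4 - ∑ j : Fin N,
    fFun N s ⟨j, by omega⟩ z * fFun N s ⟨N + j, by omega⟩ z := rfl
  simp only [toPolydiskAlgebra, Subalgebra.coe_add, Subalgebra.coe_mul,
    AddSubmonoidClass.coe_finsetSum, ContinuousMap.add_apply, ContinuousMap.sum_apply, ContinuousMap.mul_apply,
    ContinuousMap.restrict_apply, Subalgebra.coe_one, ContinuousMap.one_apply, hg]
  have h4 : ((4 : polydiskAlgebra (4 * N)) : C(closedPolydisk (4 * N), ℂ)) z = 4 := rfl
  rw [h4, mul_sub, Finset.mul_sum]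
  simp only [mul_assoc, mul_comm (fFun N s ⟨N + _, _⟩ _)]
  norm_num

end Tuples

theorem mainTheorem4 (N s : ℕ) (hN : 1 ≤ N) (hs : 1 ≤ s) :
    IsInvertibleTuple (polydiskTuple N s) ∧
    ¬ IsReducibleTuple (polydiskTuple N s) ∧
    IsInvertibleTuple (torusTuple N s) ∧
    ¬ IsReducibleTuple (torusTuple N s) := by
  have h := isInvertibleTuple_polydiskTuple N s
  have hn := not_isReducibleTuple_torusTuple (N := N) hs
  refine ⟨h, fun hr => hn ?_, ?_, hn⟩
  · simpa only [RingHom.coe_coe, restrictTorus_polydiskTuple] using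
      hr.map (restrictTorus (4 * N) : polydiskAlgebra (4 * N) →+* C(torus (4 * N), ℂ))
  · simpa only [RingHom.coe_coe, restrictTorus_polydiskTuple] using
      h.map (restrictTorus (4 * N) : polydiskAlgebra (4 * N) →+* C(torus (4 * N), ℂ))
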